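/- Setting. There are $n$ machines (agents); machine $i$ has a private speed $v_i\in\{1,\alpha\}$, where $\alpha=\tfrac14 n^{1/2}$, and the speed profile $v$ is uniformly distributed on $\{1,\alpha\}^n$. There are $n$ jobs of length $1$ and $n$ jobs of length $\alpha$. Each machine receives at most one job, so an allocation is a vector $x\in\{0,1,\alpha\}^n$; all jobs not allocated to the $n$ machines are processed by one additional machine of known speed $n(\alpha+1)$. The makespan is the maximum load of any machine, $$\phi(x,v)=\max\Big\{\max_{i}\frac{x_i}{v_i},\ \frac{n(\alpha+1)-\sum_i x_i}{n(\alpha+1)}\Big\}.$$ For $x_{\mathrm{bad}}\in\{0,1,\alpha\}^n$ let $\mathcal F_{x_{\mathrm{bad}}}=\{0,1,\alpha\}^n\setminus\{x_{\mathrm{bad}}\}$ be the feasibility constraint that forbids exactly the allocation $x_{\mathrm{bad}}$. For a (possibly randomized) algorithm $\mathcal A$ mapping speed profiles to allocations, let $\overline\phi(\mathcal A)$ be its expected makespan, over the uniform $v$ and the randomness of $\mathcal A$. A black-box transformation $\mathcal T$ is a (possibly randomized) procedure which, on input $v\in\{1,\alpha\}^n$, adaptively queries a given algorithm $\mathcal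 A:\{1,\alpha\}^n\to\mathbb R^n$ at profiles in $\{1,\alpha\}^n$ and then outputs a vector in $\mathbb R^n$; it knows $n$ and the distribution of $v$, but not the feasibility constraint. The resulting randomized algorithm is denoted $\mathcal T(\mathcal A)$. A randomized algorithm is Bayesian incentive compatible (BIC) if its expected allocations exist and there is a payment rule with which, for every agent $i$, reporting the true value $v_i$ maximizes the expected utility $\mathbf E[v_i x_i-p_i]$ over all reports in $\{1,\alpha\}$, the expectation being over the other agents' independent uniform values and the randomness of the mechanism. The transformation $\mathcal T$ is BIC if $\mathcal T(\mathcal A)$ is BIC for every $\mathcal A$. Theorem. There are an absolute constant $c>0$ and an $N$ such that for all $n\ge N$ the following holds. Let $\mathcal T$ be any BIC black-box transformation that makes at most $e^{n^{1/4}/2}$ queries to the given algorithm on each input. Then there are an allocation $x_{\mathrm{bad}}\in\{0,1,\alpha\}^n$ and a deterministic algorithm $\mathcal A:\{1,\alpha\}^n\to\mathcal F_{x_{\mathrm{bad}}}$ with $\overline\phi(\mathcal A)<2$ such that either, on some input, $\mathcal T(\mathcal A)$ returns an allocation outside $\mathcal F_{x_{\mathrm{bad}}}$ with positive probability, or $$\overline\phi(\mathcal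 T(\mathcal A))\ \ge\ c\,n^{1/4}\,\overline\phi(\mathcal A).$$ -/

import Mathlib

open scoped BigOperators
open MeasureTheory

noncomputable section

/-! ### Profiles, mechanisms and Bayesian incentive compatibility -/

/-- Value profiles of `n` agents, each of whose private values lies in the finite set `V`. -/
abbrev Profile (n : ℕ) (V : Finset ℝ) : Type := Fin n → V

/-- A deterministic algorithm: it maps each value profile to an allocation in `ℝⁿ`. -/
abbrev DetAlgorithm (n : ℕ) (V : Finset ℝ) : Type := Profile n V → (Fin n → ℝ)

/-- A randomized algorithm, as a deterministic algorithm for each value of the random seed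
`ω : Ω`. -/
abbrev RandAlgorithm (Ω : Type*) (n : ℕ) (V : Finset ℝ) : Type _ := Ω → DetAlgorithm n V

/-- The expected utility of agent `i` with true value `v` who declares `b`, in the mechanism with
allocation rule `X` and payment rule `p`. The other agents' values are independent and uniform on
`V` (the profile `w` is averaged over all of `Vⁿ`, and its `i`-th entry is overwritten by `b`), and
the randomness `ω` of the mechanism has law `P`. -/
def expectedUtility {Ω : Type*} [MeasurableSpace Ω] (P : Measure Ω) {n : ℕ} {V : Finset ℝ}
    (X p : RandAlgorithm Ω n V) (i : Fin n) (v b : V) : ℝ :=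
  𝔼 w : Profile n V, ∫ ω, ((v : ℝ) * X ω (Function.update w i b) i
    - p ω (Function.update w i b) i) ∂P

/-- The randomized algorithm `X` is Bayesian incentive compatible for the uniform distribution on
`Vⁿ`: its expected allocations exist, and there is a (possibly randomized) payment rule with
which truthful reporting maximizes each agent's expected utility. -/
def IsBIC {Ω : Type*} [MeasurableSpace Ω] (P : Measure Ω) {n : ℕ} {V : Finset ℝ}
    (X : RandAlgorithm Ω n V) : Prop :=
  (∀ w i, Integrable (fun ω => X ω w i) P) ∧
  ∃ p : RandAlgorithm Ω n V, (∀ w i, Integrable (fun ω => p ω w i) P) ∧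
    ∀ (i : Fin n) (v b : V), expectedUtility P X p i v b ≤ expectedUtility P X p i v v

/-! ### Black-box transformations -/

/-- A deterministic adaptive query procedure: it either stops with an output in `O`, or it queries
an oracle at a point of `Q` and continues according to the answer in `R`. -/
inductive QueryTree (Q R O : Type) : Type
  | output (o : O) : QueryTree Q R O
  | query (q : Q) (next : R → QueryTree Q R O) : QueryTree Q R O

/-- The output of a query procedure when its queries are answered by the oracle `A`. -/
def QueryTree.run {Q R O : Type} (A : Q → R) : QueryTree Q R O → O
  | .output o => o
  | .query q next => (next (A q)).run A

/-- The number of queries made when they are answered by the oracle `A`. -/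
def QueryTree.numQueries {Q R O : Type} (A : Q → R) : QueryTree Q R O → ℕ
  | .output _ => 0
  | .query q next => (next (A q)).numQueries A + 1

/-- A (randomized) black-box transformation. Given the random seed `ω` and an input profile `v`, it
runs an adaptive query procedure that evaluates the given algorithm at profiles of its choice, and
finally outputs an allocation. -/
abbrev Transformation (Ω : Type*) (n : ℕ) (V : Finset ℝ) : Type _ :=
  Ω → Profile n V → QueryTree (Profile n V) (Fin n → ℝ) (Fin n → ℝ)

/-- The randomized algorithm `T(A)` obtained when `T` has black-box access to `A`. -/
def Transformation.apply {Ω : Type*} {n : ℕ} {V : Finset ℝ} (T : Transformation Ω n V)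
    (A : DetAlgorithm n V) : RandAlgorithm Ω n V :=
  fun ω v => (T ω v).run A

/-- The transformation `T` is BIC if `T(A)` is a BIC algorithm for every algorithm `A`. -/
def Transformation.IsBIC {Ω : Type*} [MeasurableSpace Ω] (P : Measure Ω) {n : ℕ} {V : Finset ℝ}
    (T : Transformation Ω n V) : Prop :=
  ∀ A : DetAlgorithm n V, _root_.IsBIC P (T.apply A)

/-- On each input, `T` makes at most `q` queries to the algorithm it is given. -/
def Transformation.QueriesAtMost {Ω : Type*} {n : ℕ} {V : Finset ℝ} (T : Transformation Ω n V)
    (q : ℝ) : Prop :=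
  ∀ (A : DetAlgorithm n V) (ω : Ω) (v : Profile n V), ((T ω v).numQueries A : ℝ) ≤ q

/-! ### The makespan problem -/

/-- The makespan of the allocation `x` on machines with speeds `v`, for a set of `n` jobs of
length `1` and `n` jobs of length `α`: the largest load `x i / v i` of any machine, where an
additional machine of known speed `n * (α + 1)` processes all jobs that are not allocated to the
`n` agents. -/
def makespan (α : ℝ) {n : ℕ} {V : Finset ℝ} (x : Fin n → ℝ) (v : Profile n V) : ℝ :=
  max (⨆ i, x i / (v i : ℝ)) (((n : ℝ) * (α + 1) - ∑ i, x i) / ((n : ℝ) * (α + 1)))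

/-- The expected makespan of a deterministic algorithm, for the uniform distribution on `Vⁿ`. -/
def expectedMakespan (α : ℝ) {n : ℕ} {V : Finset ℝ} (A : DetAlgorithm n V) : ℝ :=
  𝔼 v : Profile n V, makespan α (A v) v

/-- The expected makespan of a randomized algorithm with randomness of law `P`, for the uniform
distribution on `Vⁿ`. -/
def expectedMakespanRand (α : ℝ) {Ω : Type*} [MeasurableSpace Ω] (P : Measure Ω) {n : ℕ}
    {V : Finset ℝ} (X : RandAlgorithm Ω n V) : ℝ :=
  𝔼 v : Profile n V, ∫ ω, makespan α (X ω v) v ∂P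

/-- The allocations `{0, 1, α}ⁿ`, in which each machine gets at most one job. -/
def allocations (n : ℕ) (α : ℝ) : Set (Fin n → ℝ) := {x | ∀ i, x i = 0 ∨ x i = 1 ∨ x i = α}

/-- The feasibility constraint that allows every allocation in `{0, 1, α}ⁿ` except `bad`. -/
def feasible {n : ℕ} (α : ℝ) (bad : Fin n → ℝ) : Set (Fin n → ℝ) := allocations n α \ {bad}

end

/-! The obstruction is a tension between monotonicity and hidden information. On a balanced profile
the hard algorithm gives every slow agent a short job, and gives long jobs only to a sparse random
set of fast agents. Its makespan there is at most 1, but fast agents receive less on average than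
slow ones. Incentive compatibility demands the opposite: for each agent, the speed sign and the
expected allocation are nonnegatively correlated (`IsBIC.sum_speedSign_nonneg`).

A transformation that is never infeasible can almost surely return only allocations it has observed
(`Transformation.ae_exists_query`): if it returned an unseen `x`, forbidding `x` and erasing it from
the algorithm's values would leave every answer unchanged. So on input `v` it returns the allocation
of some queried `w`. If many slow agents of `v` are exposed at `w`, the hidden set very likely hits
one of them, and the makespan is at least `α`. Otherwise `w` is close to `v`, and the correlation
with the speeds of `v` is at most `-n/8`. Adaptive querying helps little, because each fresh query
is lucky with exponentially small probability (`QueryTree.sum_lucky_le`).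

Both cases enter one linear inequality, `sum_speedSign_mul_labelAlloc_le_makespan`. Averaging it
over labels, profiles and seeds, and using that the mean correlation is nonnegative, forces the
makespan of the transformed algorithm to be of order `α` for some labels, more than the `2 * n ^
(1/4)` allowed by the negated conclusion. -/

noncomputable section

/-! ### Query trees -/

namespace QueryTree

variable {Q R O : Type} [DecidableEq Q]

/-- The set of points that are queried when the queries are answered by the oracle `A`. -/
def queries (A : Q → R) : QueryTree Q R O → Finset Q
  | .output _ => ∅
  | .query q next => insert q ((next (A q)).queries A)

theorem card_queries_le (A : Q → R) (t : QueryTree Q R O) :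
    (t.queries A).card ≤ t.numQueries A := by
  induction t with
  | output o => simp [queries, numQueries]
  | query q next ih =>
    exact (Finset.card_insert_le _ _).trans (Nat.add_le_add_right (ih _) 1)

theorem run_congr {A B : Q → R} (t : QueryTree Q R O) (h : ∀ w ∈ t.queries A, A w = B w) :
    t.run A = t.run B := by
  induction t with
  | output o => rfl
  | query q next ih =>
    have hq : A q = B q := h q (Finset.mem_insert_self _ _)
    rw [run, run, ← hq]
    exact ih _ fun w hw => h w (Finset.mem_insert_of_mem hw)

/-- The answer at `w` cannot influence the procedure before `w` is queried. This gives the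
independence used in `sum_lucky_le`. -/
theorem mem_queries_congr {A B : Q → R} {w : Q} (h : ∀ u, u ≠ w → A u = B u)
    (t : QueryTree Q R O) : w ∈ t.queries A ↔ w ∈ t.queries B := by
  induction t with
  | output o => rfl
  | query q next ih =>
    by_cases hq : q = w
    · subst hq; simp [queries]
    · rw [queries, queries, Finset.mem_insert, Finset.mem_insert, ← h q hq, ih]

end QueryTree

/-! ### Averages over finite products -/

/-- Resampling one coordinate preserves the uniform law: exchanging `w i` with `b` is an involution
on pairs. -/
theorem sum_sum_update {ι β : Type*} [Fintype ι] [DecidableEq ι] [Fintype β] (i : ι)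
    (F : (ι → β) → ℝ) :
    ∑ w : ι → β, ∑ b : β, F (Function.update w i b) = Fintype.card β * ∑ w, F w := by
  let σ : (ι → β) × β → (ι → β) × β := fun z => (Function.update z.1 i z.2, z.1 i)
  have hσ : Function.Involutive σ := fun z => by simp [σ]
  rw [← Fintype.sum_prod_type' (f := fun w b => F (Function.update w i b)),
    ← Equiv.sum_comp hσ.toPerm, Fintype.sum_prod_type]
  simp [σ, Finset.mul_sum]

theorem sum_mul_apply_of_indep {ι β : Type*} [Fintype ι] [DecidableEq ι] [Fintype β] (i : ι)
    (f : (ι → β) → ℝ) (hf : ∀ w b, f (Function.update w i b) = f w) (g : β → ℝ) :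
    Fintype.card β * ∑ w, f w * g (w i) = (∑ w, f w) * ∑ b, g b := by
  rw [← sum_sum_update i, Finset.sum_mul]
  simp [hf, Finset.mul_sum]

/-- The values of a random function at adaptively chosen points: the number of functions `S` for
which some queried point `w` has `lucky w (S w)` is at most the number of queries times the largest
probability of being lucky. -/
theorem QueryTree.sum_lucky_le {Q R O β : Type} [Fintype Q] [DecidableEq Q] [Fintype β]
    (a : Q → β → R) (t : QueryTree Q R O) (lucky : Q → β → Prop) {p q : ℝ} (hp0 : 0 ≤ p)
    [∀ w b, Decidable (lucky w b)]
    (hp : ∀ w, ∑ b, (if lucky w b then (1 : ℝ) else 0) ≤ p * Fintype.card β)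
    (hq : ∀ S : Q → β, (t.numQueries (fun w => a w (S w)) : ℝ) ≤ q) :
    ∑ S : Q → β, (if ∃ w ∈ t.queries (fun w => a w (S w)), lucky w (S w) then (1 : ℝ) else 0)
      ≤ q * p * Fintype.card (Q → β) := by
  classical
  have h1 : ∀ S : Q → β,
      (if ∃ w ∈ t.queries (fun w => a w (S w)), lucky w (S w) then (1 : ℝ) else 0) ≤
      ∑ w, (if w ∈ t.queries (fun w => a w (S w)) then (1 : ℝ) else 0) *
        (if lucky w (S w) then 1 else 0) := by
    intro S
    have h0 : ∀ w ∈ Finset.univ, (0 : ℝ) ≤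
        (if w ∈ t.queries (fun w => a w (S w)) then (1 : ℝ) else 0) *
        (if lucky w (S w) then 1 else 0) := by
      intro w _; split_ifs <;> norm_num
    split_ifs with h
    · obtain ⟨w, hw, hl⟩ := h
      refine le_trans ?_ (Finset.single_le_sum h0 (Finset.mem_univ w))
      simp [hw, hl]
    · exact Finset.sum_nonneg h0
  -- Whether `w` is queried does not depend on `S w`, whereas luck at `w` depends only on `S w`, so
  -- the two events are independent.
  have h2 : ∀ w, ∑ S : Q → β, (if w ∈ t.queries (fun w => a w (S w)) then (1 : ℝ) else 0) *
        (if lucky w (S w) then 1 else 0) ≤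
        (∑ S : Q → β, (if w ∈ t.queries (fun w => a w (S w)) then (1 : ℝ) else 0)) * p := by
    intro w
    rcases isEmpty_or_nonempty β with hβ | hβ
    · have : IsEmpty (Q → β) := ⟨fun S => hβ.elim (S w)⟩
      simp
    have hc : (0 : ℝ) < Fintype.card β := by exact_mod_cast Fintype.card_pos
    have := sum_mul_apply_of_indep w
      (fun S : Q → β => if w ∈ t.queries (fun w => a w (S w)) then (1 : ℝ) else 0)
      (fun S b => by
        have := t.mem_queries_congr (w := w) (A := fun u => a u (Function.update S w b u))
          (B := fun u => a u (S u)) (fun u hu => by simp [hu])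
        simp only [this])
      (fun b => if lucky w b then (1 : ℝ) else 0)
    refine le_of_mul_le_mul_left ?_ hc
    rw [this]
    refine (mul_le_mul_of_nonneg_left (hp w)
      (Finset.sum_nonneg fun S _ => by split_ifs <;> norm_num)).trans (le_of_eq (by ring))
  calc _ ≤ ∑ S : Q → β, ∑ w, (if w ∈ t.queries (fun w => a w (S w)) then (1 : ℝ) else 0) *
        (if lucky w (S w) then 1 else 0) := Finset.sum_le_sum fun S _ => h1 S
    _ = ∑ w, ∑ S : Q → β, (if w ∈ t.queries (fun w => a w (S w)) then (1 : ℝ) else 0) *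
        (if lucky w (S w) then 1 else 0) := Finset.sum_comm
    _ ≤ ∑ w, (∑ S : Q → β, (if w ∈ t.queries (fun w => a w (S w)) then (1 : ℝ) else 0)) * p :=
        Finset.sum_le_sum fun w _ => h2 w
    _ = (∑ S : Q → β, ((t.queries (fun w => a w (S w))).card : ℝ)) * p := by
        rw [← Finset.sum_mul, Finset.sum_comm]; simp
    _ ≤ (∑ _S : Q → β, q) * p := by
        gcongr with S
        exact le_trans (by exact_mod_cast t.card_queries_le _) (hq S)
    _ = _ := by simp; ring

/-- The exponential moment factors over coordinates, each contributing `1 + (e - 1) / (k + 1)`, and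
`e < 3`. It feeds the Chernoff bound in `card_many_zeros_le`. -/
theorem sum_exp_card_le (n k : ℕ) :
    ∑ s : Fin n → Fin (k + 1), Real.exp (∑ i, if s i = 0 then (1 : ℝ) else 0) ≤
      Real.exp (2 * n / (k + 1)) * Fintype.card (Fin n → Fin (k + 1)) := by
  have h1 : ∑ b : Fin (k + 1), Real.exp (if b = 0 then (1 : ℝ) else 0) = Real.exp 1 + k := by
    rw [Fin.sum_univ_succ]; simp [Fin.succ_ne_zero]
  have h2 : ∑ s : Fin n → Fin (k + 1), Real.exp (∑ i, if s i = 0 then (1 : ℝ) else 0) =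
      (Real.exp 1 + k) ^ n := by
    simp_rw [Real.exp_sum]
    rw [← h1, Fintype.sum_pow]
  have hk : (0 : ℝ) < k + 1 := by positivity
  have h3 : Real.exp 1 + k ≤ Real.exp (2 / (k + 1)) * (k + 1) := by
    have := Real.add_one_le_exp (2 / ((k : ℝ) + 1))
    have h4 : (2 / ((k : ℝ) + 1) + 1) * (k + 1) = 2 + (k + 1) := by field_simp
    have := Real.exp_one_lt_d9
    nlinarith
  rw [h2]
  calc (Real.exp 1 + k) ^ n ≤ (Real.exp (2 / (k + 1)) * (k + 1)) ^ n := by gcongr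
    _ = _ := by
      rw [mul_pow, ← Real.exp_nat_mul]
      simp only [Fintype.card_pi, Fintype.card_fin, Finset.prod_const, Finset.card_univ]
      push_cast
      congr 2; ring

theorem card_many_zeros_le (n k : ℕ) :
    ∑ s : Fin n → Fin (k + 1),
      (if 3 * n / (k + 1) < ∑ i, (if s i = 0 then (1 : ℝ) else 0) then (1 : ℝ) else 0) ≤
      Real.exp (-(n / (k + 1))) * Fintype.card (Fin n → Fin (k + 1)) := by
  have h : ∀ s : Fin n → Fin (k + 1),
      (if 3 * n / (k + 1) < ∑ i, (if s i = 0 then (1 : ℝ) else 0) then (1 : ℝ) else 0) ≤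
      Real.exp (-(3 * n / (k + 1))) * Real.exp (∑ i, if s i = 0 then (1 : ℝ) else 0) := by
    intro s
    rw [← Real.exp_add]
    split_ifs with h
    · exact Real.one_le_exp (by linarith)
    · positivity
  refine (Finset.sum_le_sum fun s _ => h s).trans ?_
  rw [← Finset.mul_sum]
  refine (mul_le_mul_of_nonneg_left (sum_exp_card_le n k) (Real.exp_nonneg _)).trans
    (le_of_eq ?_)
  rw [← mul_assoc, ← Real.exp_add]
  congr 2; ring

theorem card_avoiding_le (n k : ℕ) (B : Finset (Fin n)) :
    ∑ s : Fin n → Fin (k + 1), (if ∀ i ∈ B, s i ≠ 0 then (1 : ℝ) else 0) ≤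
      Real.exp (-(B.card / (k + 1))) * Fintype.card (Fin n → Fin (k + 1)) := by
  classical
  have h1 : ∀ s : Fin n → Fin (k + 1), (if ∀ i ∈ B, s i ≠ 0 then (1 : ℝ) else 0) =
      ∏ i, (if i ∈ B ∧ s i = 0 then (0 : ℝ) else 1) := by
    intro s
    split_ifs with h
    · exact (Finset.prod_eq_one fun i _ => if_neg fun hi => h i hi.1 hi.2).symm
    · push Not at h
      obtain ⟨i, hi, hs⟩ := h
      rw [Finset.prod_eq_zero (Finset.mem_univ i)]
      simp [hi, hs]
  have hk : (0 : ℝ) < k + 1 := by positivity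
  have h2 : ∀ i, ∑ b : Fin (k + 1), (if i ∈ B ∧ b = 0 then (0 : ℝ) else 1) =
      if i ∈ B then (k : ℝ) else k + 1 := by
    intro i
    rw [Fin.sum_univ_succ]
    by_cases hi : i ∈ B <;> simp [hi, Fin.succ_ne_zero]; ring
  have h3 : ∀ i, (if i ∈ B then (k : ℝ) else k + 1) ≤
      (if i ∈ B then Real.exp (-(1 / (k + 1))) else 1) * (k + 1) := by
    intro i
    split_ifs
    · have := Real.add_one_le_exp (-(1 / ((k : ℝ) + 1)))
      have h4 : (-(1 / ((k : ℝ) + 1)) + 1) * (k + 1) = k := by field_simp; ring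
      nlinarith
    · simp
  calc _ = ∑ s : Fin n → Fin (k + 1), ∏ i, (if i ∈ B ∧ s i = 0 then (0 : ℝ) else 1) :=
        Finset.sum_congr rfl fun s _ => h1 s
    _ = ∏ i, ∑ b : Fin (k + 1), (if i ∈ B ∧ b = 0 then (0 : ℝ) else 1) := by
        rw [Finset.prod_univ_sum]; simp
    _ = ∏ i : Fin n, (if i ∈ B then (k : ℝ) else k + 1) := by simp_rw [h2]
    _ ≤ ∏ i : Fin n, ((if i ∈ B then Real.exp (-(1 / (k + 1))) else 1) * ((k : ℝ) + 1)) :=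
        Finset.prod_le_prod (fun i _ => by split_ifs <;> positivity) fun i _ => h3 i
    _ = _ := by
        rw [Finset.prod_mul_distrib, Finset.prod_ite_mem, Finset.univ_inter, Finset.prod_const,
          ← Real.exp_nat_mul]
        simp only [Fintype.card_pi, Fintype.card_fin, Finset.prod_const, Finset.card_univ]
        push_cast
        congr 2; ring

/-! ### Fast and slow agents -/

/-- `1` for a fast agent (of speed `α`) and `-1` for a slow one. -/
def speedSign (α : ℝ) {V : Finset ℝ} (a : V) : ℝ := if (a : ℝ) = α then 1 else -1

theorem speedSign_mul_self (α : ℝ) {V : Finset ℝ} (a : V) :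
    speedSign α a * speedSign α a = 1 := by
  unfold speedSign; split_ifs <;> norm_num

theorem sum_pair {α : ℝ} (hα : 1 < α) (f : ℝ → ℝ) :
    ∑ a : ({1, α} : Finset ℝ), f a = f 1 + f α := by
  rw [Finset.sum_coe_sort ({1, α} : Finset ℝ) f, Finset.sum_pair hα.ne]

theorem card_pair {α : ℝ} (hα : 1 < α) : Fintype.card ({1, α} : Finset ℝ) = 2 := by
  rw [Fintype.card_coe, Finset.card_pair hα.ne]

/-- The number of fast agents and the number of slow agents differ by at most `n / 32`. -/
def IsBalanced (α : ℝ) {n : ℕ} {V : Finset ℝ} (v : Profile n V) : Prop :=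
  |∑ i, speedSign α (v i)| ≤ n / 32

theorem sum_sq_speedSign {α : ℝ} (hα : 1 < α) (n : ℕ) :
    ∑ v : Profile n {1, α}, (∑ i, speedSign α (v i)) ^ 2 =
      n * Fintype.card (Profile n {1, α}) := by
  have h : ∀ i j : Fin n, ∑ v : Profile n {1, α}, speedSign α (v i) * speedSign α (v j) =
      if i = j then (Fintype.card (Profile n {1, α}) : ℝ) else 0 := by
    intro i j
    split_ifs with hij
    · subst hij; simp [speedSign_mul_self]
    · have := sum_mul_apply_of_indep j (fun v : Profile n {1, α} => speedSign α (v i))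
        (fun w b => by simp [hij]) (speedSign α)
      have h0 : ∑ a : ({1, α} : Finset ℝ), speedSign α a = 0 := by
        have := sum_pair hα (fun a => if a = α then (1 : ℝ) else -1)
        simpa [speedSign, hα.ne] using this
      rw [h0, mul_zero, card_pair hα] at this
      simpa using this
  simp_rw [sq, Finset.sum_mul_sum]
  rw [Finset.sum_comm]
  simp_rw [Finset.sum_comm (s := (Finset.univ : Finset (Profile n {1, α}))), h]
  simp

-- Chebyshev's inequality, with the second moment from `sum_sq_speedSign`; `1024` is `32 ^ 2`.
open Classical in
theorem sum_not_isBalanced_le {α : ℝ} (hα : 1 < α) {n : ℕ} (hn : 0 < n) :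
    ∑ v : Profile n {1, α}, (if IsBalanced α v then (0 : ℝ) else 1) ≤
      1024 / n * Fintype.card (Profile n {1, α}) := by
  have hn' : (0 : ℝ) < n := by exact_mod_cast hn
  have h : ∀ v : Profile n {1, α}, (if IsBalanced α v then (0 : ℝ) else 1) ≤
      1024 / n ^ 2 * (∑ i, speedSign α (v i)) ^ 2 := by
    intro v
    split_ifs with h
    · positivity
    · rw [IsBalanced, not_le] at h
      have h1 : ((n : ℝ) / 32) ^ 2 ≤ (∑ i, speedSign α (v i)) ^ 2 := by
        rw [← sq_abs (∑ i, speedSign α (v i))]; gcongr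
      calc (1 : ℝ) = 1024 / n ^ 2 * (n / 32) ^ 2 := by field_simp; norm_num
        _ ≤ _ := by gcongr
  refine (Finset.sum_le_sum fun v _ => h v).trans (le_of_eq ?_)
  rw [← Finset.mul_sum, sum_sq_speedSign hα]
  field_simp

/-! ### Monotonicity of Bayesian incentive compatible algorithms -/

/-- Adding the two incentive constraints cancels the payments and leaves `α - 1` times the gain in
expected allocation from declaring `α` instead of `1`. -/
theorem IsBIC.sum_speedSign_nonneg {Ω : Type*} [MeasurableSpace Ω] {P : Measure Ω} {n : ℕ}
    {α : ℝ} (hα : 1 < α) {X : RandAlgorithm Ω n {1, α}} (hX : IsBIC P X) (i : Fin n) :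
    0 ≤ ∑ v : Profile n {1, α}, speedSign α (v i) * ∫ ω, X ω v i ∂P := by
  obtain ⟨hint, p, hp, hIC⟩ := hX
  let lo : ({1, α} : Finset ℝ) := ⟨1, by simp⟩
  let hi : ({1, α} : Finset ℝ) := ⟨α, by simp⟩
  have hU : ∀ a b, expectedUtility P X p i a b =
      (a * ∑ w : Profile n {1, α}, ∫ ω, X ω (Function.update w i b) i ∂P -
      ∑ w : Profile n {1, α}, ∫ ω, p ω (Function.update w i b) i ∂P) /
        Fintype.card (Profile n {1, α}) := by
    intro a b
    rw [expectedUtility, Fintype.expect_eq_sum_div_card, Finset.mul_sum, ← Finset.sum_sub_distrib]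
    congr 1
    refine Finset.sum_congr rfl fun w _ => ?_
    rw [integral_sub ((hint _ _).const_mul _) (hp _ _), integral_const_mul]
  have hc : (0 : ℝ) < Fintype.card (Profile n {1, α}) := by
    have : Nonempty (Profile n {1, α}) := ⟨fun _ => lo⟩
    exact_mod_cast Fintype.card_pos
  have h1 := hIC i lo hi
  have h2 := hIC i hi lo
  rw [hU, hU, div_le_div_iff_of_pos_right hc] at h1 h2
  have key := sum_sum_update i
    (fun v : Profile n {1, α} => speedSign α (v i) * ∫ ω, X ω v i ∂P)
  have hs : ∀ w : Profile n {1, α}, ∑ b, speedSign α (Function.update w i b i) *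
      ∫ ω, X ω (Function.update w i b) i ∂P =
      ∫ ω, X ω (Function.update w i hi) i ∂P - ∫ ω, X ω (Function.update w i lo) i ∂P := by
    intro w
    have huniv : (Finset.univ : Finset ({1, α} : Finset ℝ)) = {lo, hi} := by
      ext ⟨a, ha⟩
      have : a = 1 ∨ a = α := by simpa using ha
      simpa only [Finset.mem_univ, Finset.mem_insert, Finset.mem_singleton, true_iff, lo, hi,
        Subtype.mk.injEq] using this
    have hne : lo ≠ hi := fun h => hα.ne (congrArg Subtype.val h)
    rw [huniv, Finset.sum_pair hne]
    simp [speedSign, lo, hi, hα.ne]; ring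
  simp_rw [hs] at key
  rw [Finset.sum_sub_distrib, card_pair hα] at key
  have e1 : ((lo : ℝ)) = 1 := rfl
  have e2 : ((hi : ℝ)) = α := rfl
  rw [e1] at h1
  rw [e2] at h2
  push_cast at key
  nlinarith

/-! ### Algorithms with a hidden set of agents for each profile -/

open Classical in
/-- The allocation for the profile `w` and the labels `s`. If `w` is balanced, a slow agent gets a
short job and a fast one gets a long job when its label is `0`, and nothing otherwise. If `w` is not
balanced, every agent gets a long job when its label is `0`, and a short job otherwise. -/
def labelAlloc (α : ℝ) {n k : ℕ} {V : Finset ℝ} (w : Profile n V) (s : Fin n → Fin (k + 1)) :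
    Fin n → ℝ :=
  fun i => if s i = 0 ∧ (IsBalanced α w → (w i : ℝ) = α) then α
    else if IsBalanced α w ∧ (w i : ℝ) = α then 0 else 1

open Classical in
/-- The agents that are slow in `v` and may get a long job in `labelAlloc α w s`. -/
def exposed (α : ℝ) {n : ℕ} {V : Finset ℝ} (v w : Profile n V) : Finset (Fin n) :=
  {i | (v i : ℝ) ≠ α ∧ (IsBalanced α w → (w i : ℝ) = α)}

/-- The labels `s` of the profile `w` have too many zeros, or no zero on a large exposed set. -/
def IsLucky (α : ℝ) {n k : ℕ} {V : Finset ℝ} (v w : Profile n V) (s : Fin n → Fin (k + 1)) :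
    Prop :=
  3 * n / ((k : ℝ) + 1) < ∑ i, (if s i = 0 then (1 : ℝ) else 0) ∨
    ((n : ℝ) / 64 ≤ (exposed α v w).card ∧ ∀ i ∈ exposed α v w, s i ≠ 0)

/-- `labelAlloc` with labels given by the table `S`, except that the value `x` is replaced by the
empty allocation. -/
def labelAlgorithm (α : ℝ) {n k : ℕ} {V : Finset ℝ} (S : Profile n V → Fin n → Fin (k + 1))
    (x : Fin n → ℝ) : DetAlgorithm n V :=
  open Classical in fun w => if labelAlloc α w (S w) = x then 0 else labelAlloc α w (S w)

section

variable {α : ℝ} {n k : ℕ} {V : Finset ℝ}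

open Classical in
theorem sum_isLucky_le (v w : Profile n V) :
    ∑ s : Fin n → Fin (k + 1), (if IsLucky α v w s then (1 : ℝ) else 0) ≤
      2 * Real.exp (-(n / 64 / (k + 1))) * Fintype.card (Fin n → Fin (k + 1)) := by
  have hc : (0 : ℝ) ≤ Fintype.card (Fin n → Fin (k + 1)) := Nat.cast_nonneg _
  have hk : (0 : ℝ) < k + 1 := by positivity
  have h1 : ∑ s : Fin n → Fin (k + 1),
      (if 3 * n / (k + 1) < ∑ i, (if s i = 0 then (1 : ℝ) else 0) then (1 : ℝ) else 0) ≤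
      Real.exp (-(n / 64 / (k + 1))) * Fintype.card (Fin n → Fin (k + 1)) := by
    refine (card_many_zeros_le n k).trans ?_
    gcongr
    have : (0 : ℝ) ≤ n := Nat.cast_nonneg n
    linarith
  have h2 : ∑ s : Fin n → Fin (k + 1), (if (n : ℝ) / 64 ≤ (exposed α v w).card ∧
      ∀ i ∈ exposed α v w, s i ≠ 0 then (1 : ℝ) else 0) ≤
      Real.exp (-(n / 64 / (k + 1))) * Fintype.card (Fin n → Fin (k + 1)) := by
    by_cases hB : (n : ℝ) / 64 ≤ (exposed α v w).card
    · simp only [hB, true_and]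
      refine le_trans (le_of_eq ?_) ((card_avoiding_le n k (exposed α v w)).trans ?_)
      · exact Finset.sum_congr rfl fun s _ => by congr
      · gcongr
    · simp only [hB, false_and, if_false, Finset.sum_const_zero]
      positivity
  refine le_trans ?_ ((add_le_add h1 h2).trans (le_of_eq (by ring)))
  rw [← Finset.sum_add_distrib]
  refine Finset.sum_le_sum fun s _ => ?_
  unfold IsLucky
  split_ifs <;> first | (exfalso; tauto) | norm_num

theorem labelAlloc_mem_allocations (w : Profile n V) (s : Fin n → Fin (k + 1)) :
    labelAlloc α w s ∈ allocations n α := by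
  intro i
  unfold labelAlloc
  split_ifs <;> simp

theorem card_exposed_of_not_isBalanced {v w : Profile n V} (hw : ¬IsBalanced α w) :
    ((exposed α v w).card : ℝ) = (n - ∑ i, speedSign α (v i)) / 2 := by
  classical
  have h : (n : ℝ) = ∑ _i : Fin n, (1 : ℝ) := by simp
  rw [exposed, Finset.card_filter, h, ← Finset.sum_sub_distrib, Finset.sum_div]
  push_cast
  refine Finset.sum_congr rfl fun i _ => ?_
  by_cases hi : (v i : ℝ) = α <;> simp [hi, hw, speedSign]

theorem exists_slow (hn : 0 < n) {w : Profile n V} (hw : IsBalanced α w) :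
    ∃ i, (w i : ℝ) ≠ α := by
  by_contra! h
  have hn' : (0 : ℝ) < n := by exact_mod_cast hn
  have : ∑ i, speedSign α (w i) = n := by simp [speedSign, h]
  rw [IsBalanced, this, abs_of_pos hn'] at hw
  linarith

/-- This makes the empty allocation a legal substitute for any forbidden value, and makes forbidding
it leave the algorithm unchanged. -/
theorem labelAlloc_ne_zero (hα : 1 < α) (hn : 0 < n) (w : Profile n V)
    (s : Fin n → Fin (k + 1)) : labelAlloc α w s ≠ 0 := by
  intro h
  by_cases hw : IsBalanced α w
  · obtain ⟨i, hi⟩ := exists_slow hn hw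
    have := congrFun h i
    simp [labelAlloc, hw, hi] at this
  · have := congrFun h ⟨0, hn⟩
    simp only [labelAlloc, hw, Pi.zero_apply] at this
    split_ifs at this with h1 h2
    · linarith
    · exact absurd h2.1 id
    · norm_num at this

theorem labelAlgorithm_zero (hα : 1 < α) (hn : 0 < n)
    (S : Profile n V → Fin n → Fin (k + 1)) (w : Profile n V) :
    labelAlgorithm α S 0 w = labelAlloc α w (S w) :=
  if_neg (labelAlloc_ne_zero hα hn _ _)

theorem zero_mem_allocations : (0 : Fin n → ℝ) ∈ allocations n α := fun _ => Or.inl rfl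

theorem labelAlgorithm_mem_feasible (hα : 1 < α) (hn : 0 < n)
    (S : Profile n V → Fin n → Fin (k + 1)) (x : Fin n → ℝ) (w : Profile n V) :
    labelAlgorithm α S x w ∈ feasible α x := by
  unfold labelAlgorithm
  split_ifs with h
  · exact ⟨zero_mem_allocations, fun h0 => labelAlloc_ne_zero hα hn w (S w) (h.trans h0.symm)⟩
  · exact ⟨labelAlloc_mem_allocations _ _, h⟩

/-! ### Bounds on the makespan -/

theorem one_le_speed (hα : 1 < α) (a : ({1, α} : Finset ℝ)) : (1 : ℝ) ≤ a := by
  obtain ⟨a, ha⟩ := a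
  have : a = 1 ∨ a = α := by simpa using ha
  rcases this with rfl | rfl
  · exact le_rfl
  · exact hα.le

theorem speed_eq_one {a : ({1, α} : Finset ℝ)} (ha : (a : ℝ) ≠ α) : (a : ℝ) = 1 := by
  obtain ⟨a, h⟩ := a
  have : a = 1 ∨ a = α := by simpa using h
  exact this.resolve_right ha

theorem allocations_bounds (hα : 1 < α) {x : Fin n → ℝ} (hx : x ∈ allocations n α) (i : Fin n) :
    0 ≤ x i ∧ x i ≤ α := by
  rcases hx i with h | h | h <;> rw [h] <;> constructor <;> linarith

theorem extra_load_le_one (hα : 1 < α) {x : Fin n → ℝ} (hx : ∀ i, 0 ≤ x i) :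
    ((n : ℝ) * (α + 1) - ∑ i, x i) / ((n : ℝ) * (α + 1)) ≤ 1 := by
  have : 0 ≤ ∑ i, x i := Finset.sum_nonneg fun i _ => hx i
  exact div_le_one_of_le₀ (by linarith) (by positivity)

theorem makespan_le (hα : 1 < α) (hn : 0 < n) {x : Fin n → ℝ} (hx : ∀ i, 0 ≤ x i)
    {v : Profile n V} {b : ℝ} (hb : 1 ≤ b) (h : ∀ i, x i / (v i : ℝ) ≤ b) :
    makespan α x v ≤ b := by
  have : Nonempty (Fin n) := ⟨⟨0, hn⟩⟩
  exact max_le (ciSup_le h) ((extra_load_le_one hα hx).trans hb)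

theorem makespan_le_alpha (hα : 1 < α) (hn : 0 < n) {x : Fin n → ℝ} (hx : x ∈ allocations n α)
    (v : Profile n {1, α}) : makespan α x v ≤ α := by
  have hb := allocations_bounds hα hx
  refine makespan_le hα hn (fun i => (hb i).1) hα.le fun i => ?_
  exact (div_le_self (hb i).1 (one_le_speed hα _)).trans (hb i).2

theorem div_le_makespan (x : Fin n → ℝ) (v : Profile n V) (i : Fin n) :
    x i / (v i : ℝ) ≤ makespan α x v :=
  (le_ciSup (f := fun i => x i / (v i : ℝ)) (Set.finite_range _).bddAbove i).trans
    (le_max_left _ _)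

theorem makespan_nonneg (hα : 1 < α) {x : Fin n → ℝ} (hx : x ∈ allocations n α)
    (v : Profile n {1, α}) : 0 ≤ makespan α x v := by
  refine le_max_of_le_left (Real.iSup_nonneg fun i => ?_)
  exact div_nonneg (allocations_bounds hα hx i).1 (by linarith [one_le_speed hα (v i)])

theorem makespan_labelAlgorithm_le_one (hα : 1 < α) (hn : 0 < n)
    (S : Profile n {1, α} → Fin n → Fin (k + 1)) (x : Fin n → ℝ) {w : Profile n {1, α}}
    (hw : IsBalanced α w) : makespan α (labelAlgorithm α S x w) w ≤ 1 := by
  have hb := allocations_bounds hα (labelAlgorithm_mem_feasible hα hn S x w).1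
  refine makespan_le hα hn (fun i => (hb i).1) le_rfl fun i => ?_
  have hv := one_le_speed hα (w i)
  refine div_le_one_of_le₀ ?_ (by linarith)
  unfold labelAlgorithm
  split_ifs
  · simp only [Pi.zero_apply]; linarith
  · unfold labelAlloc
    split_ifs with h1 h2
    · exact (h1.2 hw).ge
    · linarith
    · exact hv

/-- Unbalanced profiles may cost as much as `α`, but their probability is at most `1024 / n`, so
they add less than 1. -/
theorem expectedMakespan_labelAlgorithm_lt_two (hα : 1 < α) (hn : 1024 * α < n)
    (S : Profile n {1, α} → Fin n → Fin (k + 1)) (x : Fin n → ℝ) :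
    expectedMakespan α (labelAlgorithm α S x) < 2 := by
  classical
  have hn' : (0 : ℝ) < n := by linarith
  have hn0 : 0 < n := by exact_mod_cast hn'
  have hc : (0 : ℝ) < Fintype.card (Profile n {1, α}) := by
    have : Nonempty (Profile n {1, α}) := ⟨fun _ => ⟨1, by simp⟩⟩
    exact_mod_cast Fintype.card_pos
  rw [expectedMakespan, Fintype.expect_eq_sum_div_card, div_lt_iff₀ hc]
  have h : ∀ w : Profile n {1, α}, makespan α (labelAlgorithm α S x w) w ≤
      1 + α * (if IsBalanced α w then (0 : ℝ) else 1) := by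
    intro w
    split_ifs with hw
    · simpa using makespan_labelAlgorithm_le_one hα hn0 S x hw
    · have := makespan_le_alpha hα hn0 (labelAlgorithm_mem_feasible hα hn0 S x w).1 w
      linarith
  calc _ ≤ ∑ w : Profile n {1, α}, (1 + α * (if IsBalanced α w then (0 : ℝ) else 1)) :=
        Finset.sum_le_sum fun w _ => h w
    _ = Fintype.card (Profile n {1, α}) +
        α * ∑ w : Profile n {1, α}, (if IsBalanced α w then (0 : ℝ) else 1) := by
        rw [Finset.sum_add_distrib, ← Finset.mul_sum]; simp
    _ ≤ Fintype.card (Profile n {1, α}) + α * (1024 / n * Fintype.card (Profile n {1, α})) := by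
        gcongr; exact sum_not_isBalanced_le hα hn0
    _ < 2 * Fintype.card (Profile n {1, α}) := by
        have : α * (1024 / n) < 1 := by
          rw [← mul_div_assoc, div_lt_one hn']; linarith
        nlinarith

/-! ### The correlation of an allocation with the speeds -/

theorem speedSign_le_one (a : V) : speedSign α a ≤ 1 := by
  unfold speedSign; split_ifs <;> norm_num

theorem sum_speedSign_mul_le (hα : 1 < α) {x : Fin n → ℝ} (hx : x ∈ allocations n α)
    (v : Profile n V) : ∑ i, speedSign α (v i) * x i ≤ n * α := by
  have : ∀ i ∈ Finset.univ, speedSign α (v i) * x i ≤ α := fun i _ => by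
    have := allocations_bounds hα hx i
    nlinarith [speedSign_le_one (α := α) (v i)]
  simpa using Finset.sum_le_sum this

theorem sum_speedSign_mul_labelAlloc_le (hα : 1 < α) (hk : 48 * α ≤ k + 1)
    {v w : Profile n V} {s : Fin n → Fin (k + 1)} (hl : ¬IsLucky α v w s) :
    ∑ i, speedSign α (v i) * labelAlloc α w s i ≤ 2 * n := by
  have hk' : (0 : ℝ) < k + 1 := by positivity
  have hn : (0 : ℝ) ≤ n := Nat.cast_nonneg n
  rw [IsLucky, not_or, not_lt, le_div_iff₀ hk'] at hl
  have h : ∀ i ∈ Finset.univ, speedSign α (v i) * labelAlloc α w s i ≤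
      α * (if s i = 0 then (1 : ℝ) else 0) + 1 := by
    intro i _
    unfold labelAlloc speedSign
    split_ifs <;> first | linarith | tauto
  have h1 := Finset.sum_le_sum h
  rw [Finset.sum_add_distrib, ← Finset.mul_sum] at h1
  simp only [Finset.sum_const, Finset.card_univ, Fintype.card_fin, nsmul_eq_mul, mul_one] at h1
  have h0 : 0 ≤ ∑ i, (if s i = 0 then (1 : ℝ) else 0) :=
    Finset.sum_nonneg fun i _ => by split_ifs <;> norm_num
  nlinarith [hl.1]

theorem sum_speedSign_mul_labelAlloc_le_neg (hα : 1 < α) (hn : 0 < n) (hk : 48 * α ≤ k + 1)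
    {v w : Profile n V} {s : Fin n → Fin (k + 1)} (hv : IsBalanced α v)
    (hl : ¬IsLucky α v w s) (hg : ∀ i, (v i : ℝ) ≠ α → labelAlloc α w s i ≠ α) :
    ∑ i, speedSign α (v i) * labelAlloc α w s i ≤ -(n / 8) := by
  classical
  have hk' : (0 : ℝ) < k + 1 := by positivity
  have hn' : (0 : ℝ) < n := by exact_mod_cast hn
  rw [IsLucky, not_or, not_lt, le_div_iff₀ hk', not_and'] at hl
  have hB := hl.2 fun i hi hs => by
    rw [exposed, Finset.mem_filter_univ] at hi
    refine hg i hi.1 ?_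
    simp only [labelAlloc]
    rw [if_pos ⟨hs, hi.2⟩]
  rw [not_le] at hB
  have hv' := abs_le.1 hv
  -- At an unbalanced `w` all slow agents of `v` are exposed, nearly half of all agents. This is why
  -- long jobs are planted there: giving everyone a short job would offer a constant allocation of
  -- makespan 1 and no bias against fast agents.
  have hw : IsBalanced α w := by
    by_contra hw
    rw [card_exposed_of_not_isBalanced hw] at hB
    linarith
  have hw' := abs_le.1 hw
  -- Here `(1 + speedSign α (w i)) / 2` indicates that `i` is fast in `w`. Away from zero labels the
  -- bound is an equality. Summed, the main term is `-n/2`; the zeros contribute at most `n/16`, and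
  -- the imbalances and the exposed set are also small fractions of `n`.
  have h : ∀ i ∈ Finset.univ, speedSign α (v i) * labelAlloc α w s i ≤
      α * (if s i = 0 then (1 : ℝ) else 0) + speedSign α (v i) - (1 + speedSign α (w i)) / 2
        + 2 * (if i ∈ exposed α v w then (1 : ℝ) else 0) := by
    intro i _
    by_cases h1 : (v i : ℝ) = α <;> by_cases h2 : (w i : ℝ) = α <;> by_cases h3 : s i = 0 <;>
      simp [labelAlloc, speedSign, exposed, hw, h1, h2, h3] <;> linarith
  have h1 := Finset.sum_le_sum h
  rw [Finset.sum_add_distrib, Finset.sum_sub_distrib, Finset.sum_add_distrib, ← Finset.mul_sum,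
    ← Finset.mul_sum, ← Finset.sum_div, Finset.sum_add_distrib, Finset.sum_boole
      (fun i => i ∈ exposed α v w)] at h1
  simp only [Finset.sum_const, Finset.card_univ, Fintype.card_fin, nsmul_eq_mul, mul_one,
    Finset.filter_univ_mem] at h1
  have h0 : 0 ≤ ∑ i, (if s i = 0 then (1 : ℝ) else 0) :=
    Finset.sum_nonneg fun i _ => by split_ifs <;> norm_num
  nlinarith [hl.1]

-- Either no slow agent gets a long job and the correlation is at most `-n/8`, or the makespan is at
-- least `α`, so its term is at least `4 * n` and absorbs a correlation of at most `2 * n`. The last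
-- term covers unbalanced `v` and lucky labels by the trivial bound `n * α`.
open Classical in
theorem sum_speedSign_mul_labelAlloc_le_makespan (hα : 1 < α) (hn : 0 < n)
    (hk : 48 * α ≤ k + 1) (v w : Profile n {1, α}) (s : Fin n → Fin (k + 1)) :
    ∑ i, speedSign α (v i) * labelAlloc α w s i ≤
      4 * n / α * makespan α (labelAlloc α w s) v - n / 8 +
        (n * α + n / 8) *
          ((if IsBalanced α v then 0 else 1) + (if IsLucky α v w s then 1 else 0)) := by
  have hn' : (0 : ℝ) < n := by exact_mod_cast hn
  have hx : labelAlloc α w s ∈ allocations n α := labelAlloc_mem_allocations w s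
  have hm := makespan_nonneg hα hx v
  have hm' : 0 ≤ 4 * n / α * makespan α (labelAlloc α w s) v := by positivity
  have htriv := sum_speedSign_mul_le hα hx v
  have hna : 0 < n * α := by positivity
  by_cases hv : IsBalanced α v <;> by_cases hl : IsLucky α v w s <;>
    simp only [hv, hl, if_true, if_false] <;> try linarith
  by_cases hg : ∀ i, (v i : ℝ) ≠ α → labelAlloc α w s i ≠ α
  · have := sum_speedSign_mul_labelAlloc_le_neg hα hn hk hv hl hg
    linarith
  · push Not at hg
    obtain ⟨i, hi, hxi⟩ := hg
    have h1 := div_le_makespan (α := α) (labelAlloc α w s) v i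
    rw [hxi, speed_eq_one hi, div_one] at h1
    have h2 : 4 * n / α * α ≤ 4 * n / α * makespan α (labelAlloc α w s) v := by gcongr
    rw [div_mul_cancel₀ _ (by linarith)] at h2
    have := sum_speedSign_mul_labelAlloc_le hα hk hl
    linarith

end

/-! ### Transformations on algorithms with hidden sets -/

section

variable {α : ℝ} {n k : ℕ} {Ω : Type*} [MeasurableSpace Ω] {P : Measure Ω}

theorem finite_allocations : (allocations n α).Finite := by
  have : allocations n α = Set.univ.pi fun _ => ({0, 1, α} : Set ℝ) := by
    ext x; simp [allocations]
  rw [this]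
  exact Set.Finite.pi fun _ => Set.toFinite _

/-- A transformation that respects every feasibility constraint only returns observed
allocations. -/
theorem Transformation.ae_exists_query (hα : 1 < α) (hn : 0 < n) {T : Transformation Ω n {1, α}}
    (h : ∀ (S : Profile n {1, α} → Fin n → Fin (k + 1)), ∀ x ∈ allocations n α, ∀ v,
      P {ω | T.apply (labelAlgorithm α S x) ω v ∉ feasible α x} = 0) :
    ∀ᵐ ω ∂P, ∀ (S : Profile n {1, α} → Fin n → Fin (k + 1)) (v : Profile n {1, α}),
      ∃ w ∈ (T ω v).queries (fun w => labelAlloc α w (S w)),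
        T.apply (fun w => labelAlloc α w (S w)) ω v = labelAlloc α w (S w) := by
  have h1 : ∀ᵐ ω ∂P, ∀ (S : Profile n {1, α} → Fin n → Fin (k + 1)) (v : Profile n {1, α}),
      ∀ x ∈ allocations n α, T.apply (labelAlgorithm α S x) ω v ∈ feasible α x := by
    refine ae_all_iff.2 fun S => ae_all_iff.2 fun v => ?_
    exact (ae_ball_iff finite_allocations.countable).2 fun x hx => h S x hx v
  filter_upwards [h1] with ω hω S v
  by_contra! hno
  set x := T.apply (fun w => labelAlloc α w (S w)) ω v
  have hx0 : x ∈ allocations n α := by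
    have := (hω S v 0 zero_mem_allocations).1
    rwa [show labelAlgorithm α S 0 = fun w => labelAlloc α w (S w) from
      funext (labelAlgorithm_zero hα hn S)] at this
  -- Erasing the unobserved `x` changes no answer along the run, so the output is still `x`, which
  -- is now forbidden.
  refine (hω S v x hx0).2 ?_
  refine ((T ω v).run_congr fun w hw => ?_).symm
  exact (if_neg (hno w hw).symm).symm

theorem integrable_makespan [IsFiniteMeasure P] (hα : 1 < α) (hn : 0 < n) {X : Ω → Fin n → ℝ}
    (hX : ∀ i, Integrable (fun ω => X ω i) P) (hm : ∀ᵐ ω ∂P, X ω ∈ allocations n α)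
    (v : Profile n {1, α}) : Integrable (fun ω => makespan α (X ω) v) P := by
  have hmeas : AEMeasurable (fun ω => makespan α (X ω) v) P := by
    unfold makespan
    refine AEMeasurable.max ?_ ?_
    · exact AEMeasurable.iSup fun i => (hX i).aemeasurable.div_const _
    · refine AEMeasurable.div_const (AEMeasurable.const_sub ?_ _) _
      exact Finset.aemeasurable_fun_sum _ fun i _ => (hX i).aemeasurable
  refine Integrable.of_bound hmeas.aestronglyMeasurable α ?_
  filter_upwards [hm] with ω hω
  rw [Real.norm_of_nonneg (makespan_nonneg hα hω v)]
  exact makespan_le_alpha hα hn hω v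

-- The seed is fixed so that each input has a deterministic query tree. The average is over labels,
-- and a union bound over at most `q` queries controls luck.
open Classical in
theorem Transformation.sum_speedSign_mul_apply_le {Ω : Type*} (hα : 1 < α) (hn : 0 < n)
    (hk : 48 * α ≤ k + 1) {T : Transformation Ω n {1, α}} {q : ℝ} (hq : T.QueriesAtMost q)
    (ω : Ω) (hω : ∀ (S : Profile n {1, α} → Fin n → Fin (k + 1)) (v : Profile n {1, α}),
      ∃ w ∈ (T ω v).queries (fun w => labelAlloc α w (S w)),
        T.apply (fun w => labelAlloc α w (S w)) ω v = labelAlloc α w (S w)) :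
    ∑ S : Profile n {1, α} → Fin n → Fin (k + 1), ∑ v : Profile n {1, α},
      ∑ i, speedSign α (v i) * T.apply (fun w => labelAlloc α w (S w)) ω v i ≤
    ∑ S : Profile n {1, α} → Fin n → Fin (k + 1), ∑ v : Profile n {1, α},
      4 * n / α * makespan α (T.apply (fun w => labelAlloc α w (S w)) ω v) v +
    Fintype.card (Profile n {1, α} → Fin n → Fin (k + 1)) * Fintype.card (Profile n {1, α}) *
      ((n * α + n / 8) * (1024 / n + q * (2 * Real.exp (-(n / 64 / (k + 1))))) - n / 8) := by
  have hn' : (0 : ℝ) < n := by exact_mod_cast hn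
  have hna : 0 < n * α + n / 8 := by positivity
  have h1 : ∀ (S : Profile n {1, α} → Fin n → Fin (k + 1)) (v : Profile n {1, α}),
      ∑ i, speedSign α (v i) * T.apply (fun w => labelAlloc α w (S w)) ω v i ≤
        4 * n / α * makespan α (T.apply (fun w => labelAlloc α w (S w)) ω v) v + (-(n / 8) +
        (n * α + n / 8) * ((if IsBalanced α v then 0 else 1) +
          (if ∃ w ∈ (T ω v).queries (fun w => labelAlloc α w (S w)), IsLucky α v w (S w)
            then 1 else 0))) := by
    intro S v
    obtain ⟨w, hw, hx⟩ := hω S v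
    rw [hx]
    have h2 := sum_speedSign_mul_labelAlloc_le_makespan hα hn hk v w (S w)
    have h3 : (if IsLucky α v w (S w) then (1 : ℝ) else 0) ≤
        if ∃ w ∈ (T ω v).queries (fun w => labelAlloc α w (S w)), IsLucky α v w (S w)
          then 1 else 0 := by
      by_cases hl : IsLucky α v w (S w)
      · rw [if_pos hl, if_pos ⟨w, hw, hl⟩]
      · rw [if_neg hl]; split_ifs <;> norm_num
    have h4 := mul_le_mul_of_nonneg_left h3 hna.le
    linarith
  refine (Finset.sum_le_sum fun S _ => Finset.sum_le_sum fun v _ => h1 S v).trans ?_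
  simp only [Finset.sum_add_distrib, ← Finset.mul_sum]
  have h5 : ∑ S : Profile n {1, α} → Fin n → Fin (k + 1), ∑ v : Profile n {1, α},
      (if ∃ w ∈ (T ω v).queries (fun w => labelAlloc α w (S w)), IsLucky α v w (S w)
        then (1 : ℝ) else 0) ≤ Fintype.card (Profile n {1, α}) *
        (q * (2 * Real.exp (-(n / 64 / (k + 1)))) *
          Fintype.card (Profile n {1, α} → Fin n → Fin (k + 1))) := by
    rw [Finset.sum_comm]
    refine (Finset.sum_le_sum fun v _ => QueryTree.sum_lucky_le (fun w s => labelAlloc α w s)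
      (T ω v) (fun w s => IsLucky α v w s) (p := 2 * Real.exp (-(n / 64 / (k + 1))))
      (by positivity) (fun w => sum_isLucky_le v w) fun S => hq _ ω v).trans ?_
    simp
  have h6 := sum_not_isBalanced_le hα hn
  have h7 : (∑ S : Profile n {1, α} → Fin n → Fin (k + 1), ∑ v : Profile n {1, α},
      (if IsBalanced α v then (0 : ℝ) else 1)) ≤
      Fintype.card (Profile n {1, α} → Fin n → Fin (k + 1)) *
        (1024 / n * Fintype.card (Profile n {1, α})) := by
    rw [Finset.sum_const, Finset.card_univ, nsmul_eq_mul]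
    gcongr
  have h8 := mul_le_mul_of_nonneg_left (add_le_add h7 h5) hna.le
  simp only [Finset.sum_const, Finset.card_univ, nsmul_eq_mul] at h8 ⊢
  linarith

/-- Integrating the fixed-seed inequality over the seed makes the left side nonnegative by incentive
compatibility, applied for every table `S` and every agent. -/
theorem Transformation.le_of_expectedMakespanRand_le [IsProbabilityMeasure P] (hα : 1 < α)
    (hn : 0 < n) (hk : 48 * α ≤ k + 1) {T : Transformation Ω n {1, α}} {q m : ℝ}
    (hT : T.IsBIC P) (hq : T.QueriesAtMost q)
    (hT' : ∀ᵐ ω ∂P, ∀ (S : Profile n {1, α} → Fin n → Fin (k + 1)) (v : Profile n {1, α}),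
      ∃ w ∈ (T ω v).queries (fun w => labelAlloc α w (S w)),
        T.apply (fun w => labelAlloc α w (S w)) ω v = labelAlloc α w (S w))
    (hm : ∀ S : Profile n {1, α} → Fin n → Fin (k + 1),
      expectedMakespanRand α P (T.apply fun w => labelAlloc α w (S w)) ≤ m) :
    (n : ℝ) / 8 ≤ 4 * n / α * m +
      (n * α + n / 8) * (1024 / n + q * (2 * Real.exp (-(n / 64 / (k + 1))))) := by
  have hint : ∀ (S : Profile n {1, α} → Fin n → Fin (k + 1)) v i,
      Integrable (fun ω => T.apply (fun w => labelAlloc α w (S w)) ω v i) P :=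
    fun S => (hT _).1
  have hmint : ∀ (S : Profile n {1, α} → Fin n → Fin (k + 1)) (v : Profile n {1, α}),
      Integrable (fun ω => makespan α (T.apply (fun w => labelAlloc α w (S w)) ω v) v) P := by
    intro S v
    refine integrable_makespan hα hn (hint S v) ?_ v
    filter_upwards [hT'] with ω hω
    obtain ⟨w, -, hw⟩ := hω S v
    rw [hw]
    exact labelAlloc_mem_allocations _ _
  have hc : (0 : ℝ) < Fintype.card (Profile n {1, α}) := by
    have : Nonempty (Profile n {1, α}) := ⟨fun _ => ⟨1, by simp⟩⟩
    exact_mod_cast Fintype.card_pos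
  have hd : (0 : ℝ) < Fintype.card (Profile n {1, α} → Fin n → Fin (k + 1)) := by
    exact_mod_cast Fintype.card_pos
  have hle := integral_mono_ae (μ := P)
    (integrable_finsetSum _ fun S _ => integrable_finsetSum _ fun v _ =>
      integrable_finsetSum _ fun i _ => (hint S v i).const_mul (speedSign α (v i)))
    ((integrable_finsetSum _ fun S _ => integrable_finsetSum _ fun v _ =>
      (hmint S v).const_mul (4 * n / α)).add (integrable_const
      (Fintype.card (Profile n {1, α} → Fin n → Fin (k + 1)) * Fintype.card (Profile n {1, α}) *
      ((n * α + n / 8) * (1024 / n + q * (2 * Real.exp (-(n / 64 / (k + 1))))) - n / 8))))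
    (hT'.mono fun ω hω => T.sum_speedSign_mul_apply_le hα hn hk hq ω hω)
  have hL : 0 ≤ ∫ ω, ∑ S : Profile n {1, α} → Fin n → Fin (k + 1), ∑ v : Profile n {1, α},
      ∑ i, speedSign α (v i) * T.apply (fun w => labelAlloc α w (S w)) ω v i ∂P := by
    rw [integral_finsetSum _ fun S _ => integrable_finsetSum _ fun v _ =>
      integrable_finsetSum _ fun i _ => (hint S v i).const_mul (speedSign α (v i))]
    refine Finset.sum_nonneg fun S _ => ?_
    rw [integral_finsetSum _ fun v _ =>
      integrable_finsetSum _ fun i _ => (hint S v i).const_mul (speedSign α (v i))]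
    simp_rw [fun v => integral_finsetSum Finset.univ fun i _ =>
      (hint S v i).const_mul (speedSign α (v i)), integral_const_mul]
    rw [Finset.sum_comm]
    exact Finset.sum_nonneg fun i _ => (hT _).sum_speedSign_nonneg hα i
  have hR : ∫ ω, ∑ S : Profile n {1, α} → Fin n → Fin (k + 1), ∑ v : Profile n {1, α},
      4 * n / α * makespan α (T.apply (fun w => labelAlloc α w (S w)) ω v) v ∂P ≤
      Fintype.card (Profile n {1, α} → Fin n → Fin (k + 1)) *
        (Fintype.card (Profile n {1, α}) * (4 * n / α * m)) := by
    rw [integral_finsetSum _ fun S _ => integrable_finsetSum _ fun v _ =>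
      (hmint S v).const_mul (4 * n / α), ← nsmul_eq_mul, ← Finset.card_univ, ← Finset.sum_const]
    refine Finset.sum_le_sum fun S _ => ?_
    rw [integral_finsetSum _ fun v _ => (hmint S v).const_mul (4 * n / α)]
    simp_rw [integral_const_mul]
    have := hm S
    rw [expectedMakespanRand, Fintype.expect_eq_sum_div_card, div_le_iff₀ hc] at this
    rw [← Finset.mul_sum]
    have h4 : 0 ≤ 4 * n / α := by positivity
    have := mul_le_mul_of_nonneg_left this h4
    linarith
  rw [integral_add' (integrable_finsetSum _ fun S _ => integrable_finsetSum _ fun v _ =>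
      (hmint S v).const_mul (4 * n / α)) (integrable_const _), integral_const] at hle
  simp only [probReal_univ, one_smul] at hle
  have h := hL.trans (hle.trans (add_le_add_left hR _))
  have hcd := mul_pos hd hc
  refine le_of_mul_le_mul_left ?_ hcd
  linarith

end

/-- With `y = n ^ (1/4)` and `K = k + 1`, a query is lucky with probability at most `2 * exp (-y)`,
since `64 * K ≤ y ^ 3`. The query budget `exp (y / 2)` therefore leaves a total of `2 * exp (-y /
2)`. -/
theorem exp_bound {y : ℝ} (hy : 1000 ≤ y) {K : ℝ} (hK : 0 < K) (hK' : K ≤ 12 * y ^ 2 + 2) :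
    Real.exp (y / 2) * (2 * Real.exp (-(y ^ 4 / 64 / K))) ≤ 1000 / y ^ 4 := by
  have hy0 : 0 < y := by linarith
  have h1 : y ≤ y ^ 4 / 64 / K := by
    rw [div_div, le_div_iff₀ (by positivity)]
    have h2 : 64 * K ≤ y ^ 3 := by nlinarith [sq_nonneg y, mul_pos hy0 hy0]
    nlinarith [pow_pos hy0 3]
  have h2 := Real.pow_div_factorial_le_exp (y / 2) (by positivity) 4
  have h3 : Real.exp (y / 2) * (2 * Real.exp (-(y ^ 4 / 64 / K))) ≤ 2 * (Real.exp (y / 2))⁻¹ := by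
    rw [← Real.exp_neg, mul_left_comm, ← Real.exp_add]
    gcongr
    linarith
  refine h3.trans ?_
  have h4 : (0 : ℝ) < (y / 2) ^ 4 / (Nat.factorial 4 : ℕ) := by positivity
  have h5 : (Real.exp (y / 2))⁻¹ ≤ ((y / 2) ^ 4 / (Nat.factorial 4 : ℕ))⁻¹ := inv_anti₀ h4 h2
  calc 2 * (Real.exp (y / 2))⁻¹ ≤ 2 * ((y / 2) ^ 4 / (Nat.factorial 4 : ℕ))⁻¹ := by gcongr
    _ = 768 / y ^ 4 := by
      simp only [Nat.factorial]; push_cast; field_simp; norm_num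
    _ ≤ 1000 / y ^ 4 := by gcongr; norm_num

end
theorem mainTheorem2 :
    ∃ c : ℝ, 0 < c ∧ ∃ N : ℕ, ∀ n : ℕ, N ≤ n → ∀ α : ℝ, α = (n : ℝ) ^ (1 / 2 : ℝ) / 4 →
      ∀ (Ω : Type*) [MeasurableSpace Ω] (P : Measure Ω) [IsProbabilityMeasure P]
        (T : Transformation Ω n {1, α}),
        T.IsBIC P → T.QueriesAtMost (Real.exp ((n : ℝ) ^ (1 / 4 : ℝ) / 2)) →
        ∃ bad ∈ allocations n α, ∃ A : DetAlgorithm n {1, α},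
          (∀ v, A v ∈ feasible α bad) ∧
          expectedMakespan α A < 2 ∧
          ((∃ v, 0 < P {ω | T.apply A ω v ∉ feasible α bad}) ∨
            c * (n : ℝ) ^ (1 / 4 : ℝ) * expectedMakespan α A
              ≤ expectedMakespanRand α P (T.apply A)) := by
  refine ⟨1, one_pos, 1000 ^ 4, fun n hN α hα Ω _ P _ T hT hq => ?_⟩
  have hN' : (1000 : ℝ) ^ 4 ≤ n := by exact_mod_cast hN
  have hn' : (0 : ℝ) < n := lt_of_lt_of_le (by norm_num) hN'
  have hn : 0 < n := by exact_mod_cast hn'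
  set y : ℝ := (n : ℝ) ^ (1 / 4 : ℝ) with hy
  have hy4 : y ^ 4 = n := by
    rw [hy, ← Real.rpow_natCast, ← Real.rpow_mul hn'.le]; norm_num
  have hy2 : (n : ℝ) ^ (1 / 2 : ℝ) = y ^ 2 := by
    rw [hy, ← Real.rpow_natCast, ← Real.rpow_mul hn'.le]; norm_num
  rw [hy2] at hα
  have hy0 : 0 ≤ y := Real.rpow_nonneg hn'.le _
  have hy1 : 1000 ≤ y := by
    rw [← hy4] at hN'
    exact le_of_pow_le_pow_left₀ (by norm_num) hy0 hN'
  have hypos : 0 < y := by linarith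
  have hα1 : 1 < α := by rw [hα]; nlinarith
  have hαn : 1024 * α < n := by
    rw [hα, ← hy4]
    have : 1000 ^ 2 ≤ y ^ 2 := by gcongr
    nlinarith
  -- Label 0 must be rare enough that the at most `3 * n / (k + 1)` long jobs have total length at
  -- most `n / 16`, yet frequent enough to hit exposed sets; `48 * α = 12 * y ^ 2`.
  obtain ⟨k, hk, hk'⟩ : ∃ k : ℕ, 48 * α ≤ k + 1 ∧ (k : ℝ) + 1 ≤ 12 * y ^ 2 + 2 := by
    refine ⟨⌈48 * α⌉₊, (Nat.le_ceil _).trans (by linarith), ?_⟩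
    have := (Nat.ceil_lt_add_one (a := 48 * α) (by positivity)).le
    linarith
  by_contra! hcon
  have hcon' := fun S : Profile n {1, α} → Fin n → Fin (k + 1) => fun x hx =>
    hcon x hx (labelAlgorithm α S x) (labelAlgorithm_mem_feasible hα1 hn S x)
      (expectedMakespan_labelAlgorithm_lt_two hα1 hαn S x)
  have hae := T.ae_exists_query (k := k) (P := P) hα1 hn
    fun S x hx v => nonpos_iff_eq_zero.1 ((hcon' S x hx).1 v)
  -- Forbidding the empty allocation gives the unmodified algorithm, so the negated conclusion with
  -- `c = 1` bounds its transformed makespan by `2 * y`. The terms on the right are then at most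
  -- `n/25` and `n/50`, short of `n/8`.
  have hfin := T.le_of_expectedMakespanRand_le hα1 hn hk hT hq hae (m := 2 * y) fun S => by
    have h1 := (hcon' S 0 zero_mem_allocations).2
    have h2 := expectedMakespan_labelAlgorithm_lt_two hα1 hαn S 0
    rw [show labelAlgorithm α S 0 = fun w => labelAlloc α w (S w) from
      funext (labelAlgorithm_zero hα1 hn S)] at h1 h2
    nlinarith
  have hexp := exp_bound hy1 (K := (k : ℝ) + 1) (by positivity) hk'
  rw [hy4] at hexp
  have h1 : (n * α + n / 8) * (1024 / n + Real.exp (y / 2) *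
      (2 * Real.exp (-(n / 64 / ((k : ℝ) + 1))))) ≤ n * (1 / 50) := by
    calc _ ≤ (n * α + n / 8) * (1024 / n + 1000 / n) := by gcongr
      _ = 2024 * (α + 1 / 8) := by field_simp; norm_num
      _ ≤ _ := by
        rw [hα, ← hy4]
        have : 1000 ^ 2 ≤ y ^ 2 := by gcongr
        nlinarith
  have h2 : 4 * n / α * (2 * y) ≤ n * (1 / 25) := by
    rw [hα]
    have : 4 * (n : ℝ) / (y ^ 2 / 4) * (2 * y) = n * (32 / y) := by field_simp; norm_num
    rw [this]
    refine mul_le_mul_of_nonneg_left ?_ hn'.le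
    rw [div_le_iff₀ hypos]
    linarith
  linarith
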